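/- Let $G$ be an abelian group (written additively) with an isomorphism $G\cong\mathbb{Z}_4\times H$, where $H$ is abelian of odd order; write elements of $G$ as pairs $(c,h)$ with $c\in\mathbb{Z}_4$, $h\in H$. Let $a$ be the unique element of $G$ of order two and $b,-b$ the unique pair of elements of order four; also write $a,\pm b$ for their $\mathbb{Z}_4$-components, so that $a=(a,0)$ and $\pm b=(\pm b,0)$. Let $\mathcal{C}\subseteq G$ be inverse-closed with $0\notin\mathcal{C}$, and let $X(G,\mathcal{C})$ be the Cayley graph with vertex set $G$ in which $g,h$ are adjacent if and only if $h-g\in\mathcal{C}$. A graph $X$ with adjacency matrix $A$ admits perfect state transfer if there are distinct vertices $u\neq v$, a time $\tau\in\mathbb{R}$ and $\lambda\in\mathbb{C}$ with $e^{i\tau A}\mathbf{e}_v=\lambda\mathbf{e}_u$, where $\mathbf{e}_x$ is the standard basis vector indexed by $x$. For $k=0,1,2$ let $\mathcal{C}_k$ be the set of elements of $\mathcal{C}$ of order $2^km'$ with $m'$ odd. Call a subset of $G$ power-closed if it is a union of classes of the equivalence relation $g\approx h \iff \langle g\rangle=\langle h\rangle$. Then $X(G,\mathcal{C})$ admits perfect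 state transfer if and only if the following three conditions hold: (a) $\mathcal{C}$ is power-closed; (b) exactly one of $a$ and $b$ is in $\mathcal{C}$; (c) $\mathcal{C}_0=\mathcal{C}_1^*\setminus\{0\}=\mathcal{C}_2^*\setminus\{0\}$, where $\mathcal{C}_0\subseteq\{0\}\times H$ is regarded as a subset of $H$, and $\mathcal{C}_1^*,\mathcal{C}_2^*\subseteq H$ are the subsets with $\mathcal{C}_1=\{a\}\times\mathcal{C}_1^*$ and $\mathcal{C}_2=\{b,-b\}\times\mathcal{C}_2^*$ (they are unique, and they exist whenever $\mathcal{C}$ is power-closed). -/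

import Mathlib

open scoped Classical in
/-- The transition matrix `U(t) = exp(i t A)` of the continuous-time quantum walk on `X`,
where `A` is the adjacency matrix of `X` over the complex numbers. -/
noncomputable def transitionMatrix {V : Type*} [Fintype V] [DecidableEq V]
    (X : SimpleGraph V) (t : ℝ) : Matrix V V ℂ :=
  NormedSpace.exp ((Complex.I * (t : ℂ)) • X.adjMatrix ℂ)

/-- Perfect state transfer from `u` to `v` at time `τ`: `U(τ) e_v = l • e_u` for some phase
factor `l` (necessarily of absolute value one, since `U(τ)` is unitary). -/
def HasPSTFromTo {V : Type*} [Fintype V] [DecidableEq V]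
    (X : SimpleGraph V) (u v : V) (τ : ℝ) : Prop :=
  ∃ l : ℂ, (transitionMatrix X τ).mulVec (Pi.single v 1) = l • (Pi.single u 1 : V → ℂ)

/-- `X` admits perfect state transfer: it occurs between two distinct vertices at some time. -/
def AdmitsPST {V : Type*} [Fintype V] [DecidableEq V] (X : SimpleGraph V) : Prop :=
  ∃ u v : V, u ≠ v ∧ ∃ τ : ℝ, HasPSTFromTo X u v τ

/-- The power class of `g`: the elements generating the same cyclic subgroup as `g`. -/
def powerClass {G : Type*} [AddCommGroup G] (g : G) : Set G :=
  {h | AddSubgroup.zmultiples h = AddSubgroup.zmultiples g}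

/-- A subset is power-closed if it is a union of power classes. -/
def IsPowerClosed {G : Type*} [AddCommGroup G] (C : Set G) : Prop :=
  ∃ S : Set G, C = ⋃ g ∈ S, powerClass g

/-- The elements of `C` whose order is `2 ^ k * m` for some odd number `m`. -/
def twoPart {G : Type*} [AddCommGroup G] (C : Set G) (k : ℕ) : Set G :=
  {g | g ∈ C ∧ ∃ m : ℕ, Odd m ∧ addOrderOf g = 2 ^ k * m}

/-! Characters `ψ` of `G` are left eigenvectors of the adjacency matrix, with eigenvalue the
character sum `λ_ψ` over `C`. Tested against all characters, transfer between `u` and `v` becomes a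
condition on the phases `exp(iτ λ_ψ)`. Since `C = -C` gives `λ_{-ψ} = λ_ψ`, the difference `d = v -
u` satisfies `ψ d = ±1`, and every `τ(λ_ψ - λ_0)` is a multiple of `π` whose parity is read off from
`ψ d`. The eigenvalues sum to zero, so `τ/π` is rational unless `C` is empty, and the eigenvalues
are integers. By Bridges–Mena this means that `C` is power-closed. Transfer thus says that, for some
`α`, `λ_ψ - λ_0` is `0` or `2^α` modulo `2^(α+1)` according to the sign of `ψ d`
(`admitsPST_addCayley_iff`).

For `G ≃ ZMod 4 × H` necessarily `d = (2, 0)`. A character is a pair `(ζ, χ)` with `ζ^4 = 1`, and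
its eigenvalue is `∑ ζ^c S_c(χ)`, with `S_c` the character sum over the slice of `C` at `c`;
power-closure makes slices 1 and 3 equal. The congruences at `ζ = i, 1, -1` bound Fourier
coefficients of integer functions on `H` 2-adically. As `|H|` is odd, inversion transfers these
divisibilities to the values (`two_pow_dvd_of_fourier`). Away from `0` the 0/1-valued indicators of
the slices then agree; at `0` the congruences leave only `α = 1` with exactly one of `a`, `b` in
`C`. Conversely, under (a)–(c) the eigenvalues are explicit and satisfy the congruences with `α =
1`. -/

open Finset Matrix in
theorem AddChar.sum_neg_mul_sum {G : Type*} [AddCommGroup G] [Fintype G]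
    (w : G → ℂ) (y : G) :
    ∑ ψ : AddChar G ℂ, ψ (-y) * ∑ x, w x * ψ x = Fintype.card G * w y := by
  classical
  simp_rw [mul_sum]
  rw [sum_comm]
  have key : ∀ x, ∑ ψ : AddChar G ℂ, ψ (-y) * (w x * ψ x) =
      if x = y then Fintype.card G * w x else 0 := by
    intro x
    have h1 : ∀ ψ : AddChar G ℂ, ψ (-y) * (w x * ψ x) = w x * ψ (x - y) := by
      intro ψ
      rw [sub_eq_add_neg, AddChar.map_add_eq_mul]
      ring
    simp_rw [h1, ← mul_sum, AddChar.sum_apply_eq_ite, sub_eq_zero]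
    split_ifs <;> ring
  simp [key]

theorem AddChar.eq_zero_of_sum_mul_eq_zero {G : Type*} [AddCommGroup G] [Fintype G]
    {w : G → ℂ} (hw : ∀ ψ : AddChar G ℂ, ∑ x, w x * ψ x = 0) : w = 0 := by
  ext y
  have h := AddChar.sum_neg_mul_sum w y
  simp only [hw, mul_zero, Finset.sum_const_zero] at h
  simpa using h

/-- The sum of the values of `ψ` over the set `C`. -/
noncomputable def charSum {G : Type*} [AddCommGroup G] [Fintype G] (C : Set G)
    (ψ : AddChar G ℂ) : ℂ :=
  ∑ x, C.indicator 1 x * ψ x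

/-! ### Characters as eigenvectors of the Cayley graph -/

theorem SimpleGraph.addCayley_adj_iff_sub_mem {G : Type*} [AddCommGroup G] {C : Set G}
    (h0 : (0 : G) ∉ C) (hneg : ∀ g ∈ C, -g ∈ C) (u v : G) :
    (SimpleGraph.addCayley C).Adj u v ↔ v - u ∈ C := by
  rw [SimpleGraph.addCayley_adj']
  constructor
  · rintro ⟨-, g, hg, h | h⟩
    · rwa [← h, add_sub_cancel_left]
    · rw [h]
      simpa using hneg g hg
  · intro h
    refine ⟨?_, v - u, h, Or.inl (by abel)⟩
    rintro rfl
    simp [h0] at h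

open Matrix in
theorem Matrix.vecMul_exp_of_vecMul_eq_smul {n : Type*} [Fintype n] [DecidableEq n]
    {A : Matrix n n ℂ} {x : n → ℂ} {μ : ℂ} (h : x ᵥ* A = μ • x) :
    x ᵥ* NormedSpace.exp A = Complex.exp μ • x := by
  let : NormedRing (Matrix n n ℂ) := Matrix.linftyOpNormedRing
  let : NormedAlgebra ℂ (Matrix n n ℂ) := Matrix.linftyOpNormedAlgebra
  have hpow : ∀ k : ℕ, x ᵥ* A ^ k = μ ^ k • x := by
    intro k
    induction k with
    | zero => simp
    | succ k ih => rw [pow_succ, ← Matrix.vecMul_vecMul, ih, Matrix.smul_vecMul, h, smul_smul,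
        pow_succ]
  have h1 := NormedSpace.exp_series_hasSum_exp' (𝕂 := ℂ) A
  let φ : Matrix n n ℂ →+ (n → ℂ) :=
    { toFun := fun M => x ᵥ* M
      map_zero' := by simp
      map_add' := fun M N => Matrix.vecMul_add M N x }
  have hφ : Continuous φ := by
    change Continuous fun M : Matrix n n ℂ => x ᵥ* M
    fun_prop
  have h2 := h1.map φ hφ
  have h3 := (NormedSpace.exp_series_hasSum_exp' (𝕂 := ℂ) μ).smul_const x
  rw [Complex.exp_eq_exp_ℂ]
  refine h2.unique ?_
  convert h3 using 2 with k
  change x ᵥ* ((k.factorial : ℂ)⁻¹ • A ^ k) = _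
  rw [Matrix.vecMul_smul, hpow, smul_smul, smul_eq_mul]

open Matrix in
theorem vecMul_adjMatrix_addCayley {G : Type*} [AddCommGroup G] [Fintype G]
    {C : Set G} [DecidableRel (SimpleGraph.addCayley C).Adj]
    (h0 : (0 : G) ∉ C) (hneg : ∀ g ∈ C, -g ∈ C) (ψ : AddChar G ℂ) :
    (ψ : G → ℂ) ᵥ* (SimpleGraph.addCayley C).adjMatrix ℂ = charSum C ψ • (ψ : G → ℂ) := by
  ext v
  simp only [Matrix.vecMul, dotProduct, SimpleGraph.adjMatrix_apply, Pi.smul_apply, smul_eq_mul,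
    charSum, Finset.sum_mul]
  refine Fintype.sum_equiv (Equiv.subRight v) _ _ fun u => ?_
  have hadj : (SimpleGraph.addCayley C).Adj u v ↔ u - v ∈ C := by
    rw [SimpleGraph.adj_comm, SimpleGraph.addCayley_adj_iff_sub_mem h0 hneg]
  have hψ : ψ (u - v) * ψ v = ψ u := by rw [← AddChar.map_add_eq_mul, sub_add_cancel]
  by_cases h : u - v ∈ C
  · simp [hadj, h, hψ]
  · simp [hadj, h]

-- Pair both sides with every character: each is a left eigenvector of the transition matrix, and by
-- Fourier inversion the pairings determine the vector.
open Matrix in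
theorem hasPSTFromTo_addCayley_iff {G : Type*} [AddCommGroup G] [Fintype G] [DecidableEq G]
    {C : Set G} (h0 : (0 : G) ∉ C) (hneg : ∀ g ∈ C, -g ∈ C) (u v : G) (τ : ℝ) :
    HasPSTFromTo (SimpleGraph.addCayley C) u v τ ↔
      ∃ l : ℂ, ∀ ψ : AddChar G ℂ, Complex.exp (Complex.I * τ * charSum C ψ) * ψ v = l * ψ u := by
  unfold HasPSTFromTo
  refine exists_congr fun l => ?_
  have hexp : ∀ ψ : AddChar G ℂ,
      ∑ x, (transitionMatrix (SimpleGraph.addCayley C) τ *ᵥ Pi.single v 1) x * ψ x =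
      Complex.exp (Complex.I * τ * charSum C ψ) * ψ v := by
    intro ψ
    have h2 : (ψ : G → ℂ) ᵥ* transitionMatrix (SimpleGraph.addCayley C) τ =
        Complex.exp (Complex.I * τ * charSum C ψ) • (ψ : G → ℂ) := by
      refine Matrix.vecMul_exp_of_vecMul_eq_smul ?_
      have h := fun inst => @vecMul_adjMatrix_addCayley G _ _ C inst h0 hneg ψ
      rw [Matrix.vecMul_smul, h, smul_smul]
    rw [← smul_eq_mul, ← Pi.smul_apply, ← h2]
    simp [Matrix.vecMul, dotProduct, mul_comm]
  constructor
  · intro h ψ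
    rw [← hexp, h]
    simp [Pi.single_apply]
  · intro h
    rw [← sub_eq_zero]
    refine AddChar.eq_zero_of_sum_mul_eq_zero fun ψ => ?_
    simp only [Pi.sub_apply, sub_mul, Finset.sum_sub_distrib, hexp, h]
    simp [Pi.single_apply]

/-! ### Phases, integrality of eigenvalues and the 2-adic criterion -/

section charSum

variable {G : Type*} [AddCommGroup G] [Fintype G] {C : Set G}

theorem charSum_neg (hneg : ∀ g ∈ C, -g ∈ C) (ψ : AddChar G ℂ) :
    charSum C (-ψ) = charSum C ψ := by
  refine Fintype.sum_equiv (Equiv.neg G) _ _ fun x => ?_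
  have hmem : -x ∈ C ↔ x ∈ C := ⟨fun h => by simpa using hneg _ h, hneg x⟩
  by_cases h : x ∈ C <;> simp [hmem, h]

theorem AddChar.isIntegral_apply (ψ : AddChar G ℂ) (x : G) : IsIntegral ℤ (ψ x) := by
  refine IsIntegral.of_pow (n := Fintype.card G) Fintype.card_pos ?_
  rw [← AddChar.map_nsmul_eq_pow, card_nsmul_eq_zero, AddChar.map_zero_eq_one]
  exact isIntegral_one

theorem isIntegral_charSum (ψ : AddChar G ℂ) : IsIntegral ℤ (charSum C ψ) := by
  refine IsIntegral.sum _ fun x _ => IsIntegral.mul ?_ (AddChar.isIntegral_apply ψ x)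
  by_cases h : x ∈ C <;> simp [h, isIntegral_one, isIntegral_zero]

theorem Complex.exists_int_of_isIntegral_ratCast {q : ℚ} (h : IsIntegral ℤ (q : ℂ)) :
    ∃ n : ℤ, (q : ℂ) = n := by
  have h1 : IsIntegral ℤ q :=
    (isIntegral_algebraMap_iff (B := ℂ) (algebraMap ℚ ℂ).injective).1 (by simpa using h)
  obtain ⟨n, hn⟩ := IsIntegrallyClosed.isIntegral_iff.1 h1
  exact ⟨n, by rw [← hn]; simp⟩

theorem exists_int_charSum_zero (C : Set G) : ∃ k : ℤ, charSum C 0 = k := by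
  refine ⟨∑ x, C.indicator 1 x, ?_⟩
  push_cast
  refine Finset.sum_congr rfl fun x _ => ?_
  by_cases h : x ∈ C <;> simp [h]

theorem sum_charSum (h0 : (0 : G) ∉ C) : ∑ ψ : AddChar G ℂ, charSum C ψ = 0 := by
  simpa [h0, charSum] using AddChar.sum_neg_mul_sum (C.indicator (1 : G → ℂ)) 0

/-- Under perfect state transfer, all phases `τ (λ_ψ - λ_0)` are integer multiples of `π`, and the
transfer is by an element `d` of order two whose character values give the parities. -/
theorem exists_phases_of_admitsPST [DecidableEq G] (h0 : (0 : G) ∉ C) (hneg : ∀ g ∈ C, -g ∈ C)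
    (h : AdmitsPST (SimpleGraph.addCayley C)) :
    ∃ d : G, d ≠ 0 ∧ ∃ τ : ℝ, ∃ n : AddChar G ℂ → ℤ, ∀ ψ,
      τ * (charSum C ψ - charSum C 0) = Real.pi * n ψ ∧ ψ d = (-1) ^ n ψ := by
  obtain ⟨u, v, huv, τ, h⟩ := h
  obtain ⟨l, hl⟩ := (hasPSTFromTo_addCayley_iff h0 hneg u v τ).1 h
  have hl0 : Complex.exp (Complex.I * τ * charSum C 0) = l := by simpa using hl 0
  have hd : ∀ ψ : AddChar G ℂ,
      Complex.exp (Complex.I * τ * (charSum C ψ - charSum C 0)) * ψ (v - u) = 1 := by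
    intro ψ
    have hu : ψ u ≠ 0 := (ψ.val_isUnit u).ne_zero
    rw [mul_sub, Complex.exp_sub, hl0, AddChar.map_sub_eq_div, div_mul_div_comm, hl ψ]
    refine div_self (mul_ne_zero ?_ hu)
    rw [← hl0]
    exact Complex.exp_ne_zero _
  have hsq : ∀ ψ : AddChar G ℂ, ψ (v - u) * ψ (v - u) = 1 := by
    intro ψ
    have h1 := hd ψ
    have h2 := hd (-ψ)
    rw [charSum_neg hneg, AddChar.neg_apply'] at h2
    have h3 : ψ (v - u) ≠ 0 := (ψ.val_isUnit _).ne_zero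
    have h4 : Complex.exp (Complex.I * τ * (charSum C ψ - charSum C 0)) = ψ (v - u) := by
      field_simp at h2
      exact h2
    rwa [h4] at h1
  have hphase : ∀ ψ : AddChar G ℂ, ∃ n : ℤ,
      τ * (charSum C ψ - charSum C 0) = Real.pi * n ∧ ψ (v - u) = (-1) ^ n := by
    intro ψ
    have h1 : Complex.exp (Complex.I * τ * (charSum C ψ - charSum C 0)) = ψ (v - u) :=
      mul_right_cancel₀ (ψ.val_isUnit (v - u)).ne_zero ((hd ψ).trans (hsq ψ).symm)
    have h2 : Complex.exp (2 * (Complex.I * τ * (charSum C ψ - charSum C 0))) = 1 := by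
      rw [two_mul, Complex.exp_add, h1, hsq]
    obtain ⟨n, hn⟩ := Complex.exp_eq_one_iff.1 h2
    have h3 : Complex.I * (τ * (charSum C ψ - charSum C 0)) = Complex.I * (Real.pi * n) := by
      linear_combination hn / 2
    have h4 := mul_left_cancel₀ Complex.I_ne_zero h3
    refine ⟨n, h4, ?_⟩
    rw [← h1, mul_assoc, h3, ← Complex.exp_pi_mul_I, ← Complex.exp_int_mul]
    congr 1
    ring
  choose n hn using hphase
  exact ⟨v - u, sub_ne_zero.2 huv.symm, τ, n, hn⟩

/-- Summing the phase relations, with total eigenvalue zero, gives `-τ|G||C| = π ∑ n`. For nonempty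
`C` this eliminates `τ/π`, so each eigenvalue is a rational algebraic integer. -/
theorem exists_int_charSum_of_phases (h0 : (0 : G) ∉ C) {d : G} (hd : d ≠ 0) {τ : ℝ}
    {n : AddChar G ℂ → ℤ}
    (h : ∀ ψ, τ * (charSum C ψ - charSum C 0) = Real.pi * n ψ ∧ ψ d = (-1) ^ n ψ)
    (ψ : AddChar G ℂ) : ∃ m : ℤ, charSum C ψ = m := by
  have hpi : (Real.pi : ℂ) ≠ 0 := by exact_mod_cast Real.pi_ne_zero
  obtain ⟨k, hk⟩ := exists_int_charSum_zero C
  obtain ⟨χ, hχ⟩ := AddChar.exists_apply_ne_zero.2 hd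
  have hχn : n χ ≠ 0 := by
    intro h'
    have := (h χ).2
    simp [h', hχ] at this
  have hτ : (τ : ℂ) ≠ 0 := by
    intro h'
    have := (h χ).1
    simp [h', hχn, hpi] at this
  have hsum : (τ : ℂ) * (-(Fintype.card G) * k) = (Real.pi : ℂ) * (∑ ψ, n ψ : ℤ) := by
    have h1 : ∑ ψ, τ * (charSum C ψ - charSum C 0) = ∑ ψ, Real.pi * (n ψ : ℂ) :=
      Finset.sum_congr rfl fun ψ _ => (h ψ).1
    rw [← Finset.mul_sum, ← Finset.mul_sum, Finset.sum_sub_distrib, sum_charSum h0, hk] at h1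
    push_cast
    rw [← h1]
    simp
  -- Here `k = |C|`, so `k = 0` forces an empty connection set.
  rcases eq_or_ne k 0 with hk0 | hk0
  · have hC : C = ∅ := by
      rw [Set.eq_empty_iff_forall_notMem]
      intro x hx
      have h1 : (∑ y, C.indicator (1 : G → ℤ) y) = 0 := by
        have h2 : charSum C 0 = ((∑ y, C.indicator (1 : G → ℤ) y : ℤ) : ℂ) := by
          push_cast
          refine Finset.sum_congr rfl fun x _ => ?_
          by_cases h : x ∈ C <;> simp [h]
        rw [hk, hk0] at h2
        exact_mod_cast h2.symm
      rw [Finset.sum_eq_zero_iff_of_nonneg fun y _ => Set.indicator_nonneg (by simp) y] at h1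
      simpa [hx] using h1 x (Finset.mem_univ x)
    exact ⟨0, by simp [charSum, hC]⟩
  · have hN : (∑ ψ, n ψ) ≠ 0 := by
      intro h'
      rw [h'] at hsum
      simp [hτ, hk0] at hsum
    have hN' : ((∑ ψ, n ψ : ℤ) : ℂ) ≠ 0 := by exact_mod_cast hN
    have hq : charSum C ψ = ((k - Fintype.card G * k * n ψ / (∑ ψ, n ψ : ℤ) : ℚ) : ℂ) := by
      have h1 := (h ψ).1
      rw [hk] at h1
      push_cast at hN' hsum ⊢
      field_simp
      apply mul_left_cancel₀ hτ
      apply mul_left_cancel₀ hpi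
      linear_combination (Real.pi * (∑ ψ, n ψ : ℂ)) * h1 - Real.pi * (n ψ : ℂ) * hsum
    obtain ⟨m, hm⟩ := Complex.exists_int_of_isIntegral_ratCast (hq ▸ isIntegral_charSum ψ)
    exact ⟨m, hq.trans hm⟩

/-- After division by `2^α` the odd factors do not affect parity, so `M / 2^α` has the parity of
`n`. -/
theorem Int.dvd_or_dvd_sub_of_mul_eq {M n₀ u n : ℤ} {α : ℕ} (hn₀ : Odd n₀) (hu : Odd u)
    (h : M * n₀ = 2 ^ α * u * n) :
    (Even n → (2 : ℤ) ^ (α + 1) ∣ M) ∧ (Odd n → (2 : ℤ) ^ (α + 1) ∣ M - 2 ^ α) := by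
  have hcop : IsCoprime ((2 : ℤ) ^ α) n₀ := by
    obtain ⟨t, rfl⟩ := hn₀
    exact IsCoprime.pow_left ⟨-t, 1, by ring⟩
  obtain ⟨w, rfl⟩ : (2 : ℤ) ^ α ∣ M :=
    hcop.dvd_of_dvd_mul_right ⟨u * n, by rw [h]; ring⟩
  have hw : w * n₀ = u * n := by
    have h2 : (2 : ℤ) ^ α ≠ 0 := by positivity
    apply mul_left_cancel₀ h2
    linarith
  constructor
  · intro hn
    have : Even (w * n₀) := hw ▸ hn.mul_left u
    obtain ⟨t, rfl⟩ := (Int.even_mul.1 this).resolve_right (Int.not_even_iff_odd.2 hn₀)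
    exact ⟨t, by ring⟩
  · intro hn
    have : Odd (w * n₀) := hw ▸ hu.mul hn
    obtain ⟨t, rfl⟩ := (Int.odd_mul.1 this).1
    exact ⟨t, by ring⟩

theorem Int.exists_eq_two_pow_mul_odd {m : ℤ} (hm : m ≠ 0) :
    ∃ (α : ℕ) (u : ℤ), Odd u ∧ m = 2 ^ α * u := by
  obtain ⟨α, u, hu, h⟩ := Nat.exists_eq_two_pow_mul_odd (Int.natAbs_ne_zero.2 hm)
  rcases Int.natAbs_eq m with h' | h'
  · exact ⟨α, u, by exact_mod_cast hu, by rw [h', h]; push_cast; ring⟩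
  · exact ⟨α, -u, by simpa using hu, by rw [h', h]; push_cast; ring⟩

/-- Perfect state transfer on an abelian Cayley graph, in terms of the `2`-adic valuations of
the differences of eigenvalues. -/
theorem admitsPST_addCayley_iff [DecidableEq G] (h0 : (0 : G) ∉ C) (hneg : ∀ g ∈ C, -g ∈ C) :
    AdmitsPST (SimpleGraph.addCayley C) ↔
      ∃ d : G, d ≠ 0 ∧ ∃ (m : AddChar G ℂ → ℤ) (α : ℕ), ∀ ψ, charSum C ψ = m ψ ∧
        ((ψ d = 1 ∧ (2 : ℤ) ^ (α + 1) ∣ m ψ - m 0) ∨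
          (ψ d = -1 ∧ (2 : ℤ) ^ (α + 1) ∣ m ψ - m 0 - 2 ^ α)) := by
  have hpi : (Real.pi : ℂ) ≠ 0 := by exact_mod_cast Real.pi_ne_zero
  constructor
  · intro h
    obtain ⟨d, hd, τ, n, hn⟩ := exists_phases_of_admitsPST h0 hneg h
    choose m hm using exists_int_charSum_of_phases h0 hd hn
    obtain ⟨χ, hχ⟩ := AddChar.exists_apply_ne_zero.2 hd
    have hχn : Odd (n χ) := by
      rw [← Int.not_even_iff_odd]
      intro h'
      exact hχ (by rw [(hn χ).2, h'.neg_one_zpow])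
    have hτ : (τ : ℂ) ≠ 0 := by
      intro h'
      have h1 := (hn χ).1
      have h2 : n χ ≠ 0 := by
        intro h3
        simp [h3] at hχn
      simp [h', h2, hpi] at h1
    have hcross : ∀ ψ, (m ψ - m 0) * n χ = (m χ - m 0) * n ψ := by
      intro ψ
      have h1 := (hn ψ).1
      have h2 := (hn χ).1
      rw [hm, hm] at h1 h2
      have h3 : ((m ψ : ℂ) - m 0) * n χ = (m χ - m 0) * n ψ := by
        apply mul_left_cancel₀ hτ
        linear_combination (n χ : ℂ) * h1 - (n ψ : ℂ) * h2
      exact_mod_cast h3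
    have hne : m χ - m 0 ≠ 0 := by
      intro h'
      have h2 := (hn χ).1
      have h3 : (m χ : ℂ) - m 0 = 0 := by exact_mod_cast h'
      rw [hm, hm, h3] at h2
      have h4 : n χ = 0 := by simpa [hpi] using h2.symm
      simp [h4] at hχn
    -- The valuation at one character with `χ d = -1` serves as `α` for all, through `hcross`.
    obtain ⟨α, u, hu, hα⟩ := Int.exists_eq_two_pow_mul_odd hne
    refine ⟨d, hd, m, α, fun ψ => ⟨hm ψ, ?_⟩⟩
    have h1 := Int.dvd_or_dvd_sub_of_mul_eq hχn hu (hα ▸ hcross ψ)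
    rcases Int.even_or_odd (n ψ) with h' | h'
    · exact Or.inl ⟨by rw [(hn ψ).2, h'.neg_one_zpow], h1.1 h'⟩
    · exact Or.inr ⟨by rw [(hn ψ).2, h'.neg_one_zpow], h1.2 h'⟩
  · rintro ⟨d, hd, m, α, h⟩
    refine ⟨0, d, hd.symm, Real.pi / 2 ^ α, (hasPSTFromTo_addCayley_iff h0 hneg _ _ _).2
      ⟨Complex.exp (Complex.I * (Real.pi / 2 ^ α : ℝ) * charSum C 0), fun ψ => ?_⟩⟩
    have key : Complex.exp (Complex.I * (Real.pi / 2 ^ α : ℝ) * (charSum C ψ - charSum C 0)) *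
        ψ d = 1 := by
      rw [(h ψ).1, (h 0).1]
      rcases (h ψ).2 with ⟨h1, t, ht⟩ | ⟨h1, t, ht⟩
      · have h2 : (m ψ : ℂ) - m 0 = 2 ^ (α + 1) * t := by exact_mod_cast ht
        rw [h1, mul_one, h2, Complex.exp_eq_one_iff]
        refine ⟨t, ?_⟩
        push_cast
        field_simp
        ring
      · have h2 : (m ψ : ℂ) - m 0 = 2 ^ (α + 1) * t + 2 ^ α := by
          have : m ψ - m 0 = 2 ^ (α + 1) * t + 2 ^ α := by linarith
          exact_mod_cast this
        have h3 : Complex.I * (Real.pi / 2 ^ α : ℝ) * (2 ^ (α + 1) * t + 2 ^ α) =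
            t * (2 * Real.pi * Complex.I) + Real.pi * Complex.I := by
          push_cast
          field_simp
          ring
        rw [h1, h2, h3, Complex.exp_add, Complex.exp_int_mul_two_pi_mul_I, Complex.exp_pi_mul_I]
        norm_num
    have hsplit : Complex.I * (Real.pi / 2 ^ α : ℝ) * charSum C ψ =
        Complex.I * (Real.pi / 2 ^ α : ℝ) * (charSum C ψ - charSum C 0) +
          Complex.I * (Real.pi / 2 ^ α : ℝ) * charSum C 0 := by ring
    rw [hsplit, Complex.exp_add, mul_right_comm, key, AddChar.map_zero_eq_one]
    ring

end charSum

/-! ### Power-closed sets as sets stable under multipliers prime to the group order -/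

section PowerClosed

variable {G : Type*} [AddCommGroup G]

theorem isPowerClosed_iff {C : Set G} :
    IsPowerClosed C ↔ ∀ g h : G, AddSubgroup.zmultiples g = AddSubgroup.zmultiples h →
      g ∈ C → h ∈ C := by
  constructor
  · rintro ⟨S, rfl⟩ g h hgh hg
    simp only [powerClass, Set.mem_iUnion, Set.mem_ofPred_eq] at hg ⊢
    obtain ⟨i, hi, hgi⟩ := hg
    exact ⟨i, hi, hgh.symm.trans hgi⟩
  · intro h
    refine ⟨C, Set.Subset.antisymm (fun g hg => Set.mem_biUnion hg rfl) fun g hg => ?_⟩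
    obtain ⟨i, hi, hgi⟩ := Set.mem_iUnion₂.1 hg
    exact h i g hgi.symm hi

variable [Finite G]

theorem AddSubgroup.zmultiples_nsmul_of_coprime {k : ℕ} (hk : (Nat.card G).Coprime k) (g : G) :
    AddSubgroup.zmultiples (k • g) = AddSubgroup.zmultiples g := by
  refine AddSubgroup.eq_of_le_of_card_ge
    (AddSubgroup.zmultiples_le_of_mem (AddSubgroup.nsmul_mem_zmultiples g k)) ?_
  rw [Nat.card_zmultiples, Nat.card_zmultiples, Nat.Coprime.addOrderOf_nsmul]
  exact hk.coprime_dvd_left (_root_.addOrderOf_dvd_natCard g)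

theorem AddSubgroup.exists_coprime_nsmul_of_zmultiples_eq {g h : G}
    (hgh : AddSubgroup.zmultiples g = AddSubgroup.zmultiples h) :
    ∃ k : ℕ, (Nat.card G).Coprime k ∧ h = k • g := by
  have hmem : h ∈ AddSubgroup.zmultiples g := hgh ▸ AddSubgroup.mem_zmultiples h
  obtain ⟨j, rfl⟩ := (mem_multiples_iff_mem_zmultiples.2 hmem)
  have ho : addOrderOf (j • g) = addOrderOf g := by
    rw [← Nat.card_zmultiples, ← Nat.card_zmultiples, hgh]
  have hpos : 0 < addOrderOf g := addOrderOf_pos g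
  have hcop : Nat.Coprime j (addOrderOf g) := by
    rw [addOrderOf_nsmul] at ho
    have h1 := Nat.div_mul_cancel (Nat.gcd_dvd_left (addOrderOf g) j)
    rw [ho] at h1
    rw [Nat.coprime_comm]
    exact Nat.eq_of_mul_eq_mul_left hpos (by rw [h1, mul_one])
  have : NeZero (Nat.card G) := ⟨Nat.card_pos.ne'⟩
  -- `j` is only prime to the order of `g`; a unit modulo the order of `G` lifting it replaces it.
  obtain ⟨u, hu⟩ := ZMod.unitsMap_surjective (_root_.addOrderOf_dvd_natCard g)
    (ZMod.unitOfCoprime j hcop)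
  refine ⟨(u : ZMod (Nat.card G)).val, (ZMod.val_coe_unit_coprime u).symm, ?_⟩
  change j • g = _
  rw [nsmul_eq_nsmul_iff_modEq, ← ZMod.natCast_eq_natCast_iff]
  have h1 := congrArg Units.val hu
  rw [ZMod.coe_unitOfCoprime, ZMod.unitsMap_val] at h1
  rw [← h1, ZMod.natCast_val]

theorem isPowerClosed_iff_nsmul {C : Set G} :
    IsPowerClosed C ↔ ∀ k : ℕ, (Nat.card G).Coprime k → ∀ g ∈ C, k • g ∈ C := by
  rw [isPowerClosed_iff]
  constructor
  · intro h k hk g hg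
    exact h g _ (AddSubgroup.zmultiples_nsmul_of_coprime hk g).symm hg
  · intro h g g' hgg' hg
    obtain ⟨k, hk, rfl⟩ := AddSubgroup.exists_coprime_nsmul_of_zmultiples_eq hgg'
    exact h k hk g hg

end PowerClosed

/-! ### Integral character sums and power-closed sets -/

section Integrality

variable {G : Type*} [AddCommGroup G] [Fintype G] {C : Set G}

-- Galois invariance in polynomial form: `P` vanishes at the primitive root `ζ`, hence at `ζ ^ k`,
-- which has the same minimal polynomial.
open Polynomial in
theorem charSum_nsmul_of_int {ψ : AddChar G ℂ} {m : ℤ} (hm : charSum C ψ = m) {k : ℕ}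
    (hk : (Nat.card G).Coprime k) : charSum C (k • ψ) = charSum C ψ := by
  have hcard : Nat.card G ≠ 0 := Nat.card_pos.ne'
  have : NeZero (Nat.card G) := ⟨hcard⟩
  have hζ := Complex.isPrimitiveRoot_exp (Nat.card G) hcard
  set ζ := Complex.exp (2 * Real.pi * Complex.I / Nat.card G)
  have hψ : ∀ x, ∃ i : ℕ, ζ ^ i = ψ x := by
    intro x
    have h1 : ψ x ^ Nat.card G = 1 := by
      rw [← AddChar.map_nsmul_eq_pow, card_nsmul_eq_zero', AddChar.map_zero_eq_one]
    obtain ⟨i, -, hi⟩ := hζ.eq_pow_of_pow_eq_one h1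
    exact ⟨i, hi⟩
  choose e he using hψ
  let P : ℤ[X] := ∑ x, Polynomial.C (C.indicator (1 : G → ℤ) x) * X ^ e x - Polynomial.C m
  have hcast : ∀ x, ((C.indicator (1 : G → ℤ) x : ℤ) : ℂ) = C.indicator 1 x := by
    intro x
    by_cases h : x ∈ C <;> simp [h]
  have hP : ∀ j : ℕ, aeval (ζ ^ j) P = charSum C (j • ψ) - m := by
    intro j
    simp only [P, map_sub, map_sum, map_mul, map_pow, aeval_X, aeval_C]
    simp only [eq_intCast, hcast]
    congr 1
    refine Finset.sum_congr rfl fun x _ => ?_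
    rw [AddChar.nsmul_apply, ← he, ← pow_mul, ← pow_mul, mul_comm j]
  have hmin : minpoly ℤ ζ ∣ P := by
    refine minpoly.isIntegrallyClosed_dvd (hζ.isIntegral (Nat.pos_of_ne_zero hcard)) ?_
    have := hP 1
    rwa [pow_one, one_smul, hm, sub_self] at this
  rw [hζ.minpoly_eq_pow_coprime hk.symm] at hmin
  obtain ⟨Q, hQ⟩ := hmin
  have h1 := hP k
  rw [hQ, map_mul, minpoly.aeval, zero_mul] at h1
  rw [hm]
  exact (sub_eq_zero.1 h1.symm)

/-- A set all of whose character sums are integers is power-closed (Bridges–Mena). -/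
theorem isPowerClosed_of_int_charSum (h : ∀ ψ : AddChar G ℂ, ∃ m : ℤ, charSum C ψ = m) :
    IsPowerClosed C := by
  rw [isPowerClosed_iff_nsmul]
  intro k hk g hg
  have hcardG : Nat.card (AddChar G ℂ) = Nat.card G := by
    rw [Nat.card_eq_fintype_card, Nat.card_eq_fintype_card, AddChar.card_eq]
  have hbij : Function.Bijective fun ψ : AddChar G ℂ => k • ψ :=
    (nsmulCoprime (hcardG ▸ hk)).bijective
  have h1 := AddChar.sum_neg_mul_sum (C.indicator (1 : G → ℂ)) (k • g)
  have h2 := AddChar.sum_neg_mul_sum (C.indicator (1 : G → ℂ)) g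
  have h3 : ∑ ψ : AddChar G ℂ, ψ (-(k • g)) * charSum C ψ =
      ∑ ψ : AddChar G ℂ, ψ (-g) * charSum C ψ := by
    refine Fintype.sum_bijective _ hbij _ _ fun ψ => ?_
    obtain ⟨m, hm⟩ := h ψ
    rw [charSum_nsmul_of_int hm hk, AddChar.nsmul_apply, ← AddChar.map_nsmul_eq_pow, smul_neg]
  have h4 : (Fintype.card G : ℂ) * C.indicator 1 (k • g) = Fintype.card G * C.indicator 1 g := by
    rw [← h1, ← h2]
    exact h3
  have h5 : (Fintype.card G : ℂ) ≠ 0 := by exact_mod_cast Fintype.card_ne_zero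
  have h6 := mul_left_cancel₀ h5 h4
  by_contra hn
  simp [hn, hg] at h6

open scoped Classical in
theorem AddChar.exists_int_sum_subgroup (ψ : AddChar G ℂ) (K : AddSubgroup G) :
    ∃ m : ℤ, ∑ x with x ∈ K, ψ x = m := by
  have h : ∑ x with x ∈ K, ψ x = ∑ x : K, ψ x :=
    (Finset.sum_subtype _ (fun x => by simp) _)
  have h2 := AddChar.sum_eq_ite (ψ.compAddMonoidHom K.subtype)
  simp only [AddChar.compAddMonoidHom_apply, AddSubgroup.coe_subtype] at h2
  rw [h, h2]
  split_ifs
  · exact ⟨Fintype.card K, by simp⟩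
  · exact ⟨0, by simp⟩

-- Induction on `K`: the sum over all of `K` is an integer and splits according to the cyclic
-- subgroup each element generates.
open scoped Classical in
theorem AddChar.exists_int_sum_generators (ψ : AddChar G ℂ) (K : AddSubgroup G) :
    ∃ m : ℤ, ∑ x with AddSubgroup.zmultiples x = K, ψ x = m := by
  induction K using WellFoundedLT.induction with
  | ind K ih =>
    obtain ⟨m, hm⟩ := ψ.exists_int_sum_subgroup K
    have h1 : ∑ x with x ∈ K, ψ x =
        ∑ L with L ≤ K, ∑ x with AddSubgroup.zmultiples x = L, ψ x := by
      rw [← Finset.sum_fiberwise_of_maps_to (t := Finset.univ.filter (· ≤ K))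
        (g := AddSubgroup.zmultiples)]
      · refine Finset.sum_congr rfl fun L hL => Finset.sum_congr ?_ fun _ _ => rfl
        ext x
        simp only [Finset.mem_filter, Finset.mem_univ, true_and] at hL ⊢
        exact ⟨fun h => h.2, fun h => ⟨hL (h ▸ AddSubgroup.mem_zmultiples x), h⟩⟩
      · intro x hx
        simpa using hx
    have h2 : Finset.univ.filter (fun L : AddSubgroup G => L ≤ K) =
        insert K (Finset.univ.filter (· < K)) := by
      ext L
      simp [le_iff_eq_or_lt]
    rw [h2, Finset.sum_insert (by simp), hm] at h1
    choose! f hf using ih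
    have h3 : ∑ L with L < K, ∑ x with AddSubgroup.zmultiples x = L, ψ x =
        ((∑ L with L < K, f L : ℤ) : ℂ) := by
      push_cast
      refine Finset.sum_congr rfl fun L hL => hf L ?_
      simpa using hL
    refine ⟨m - ∑ L with L < K, f L, ?_⟩
    rw [h3] at h1
    rw [Int.cast_sub, h1]
    ring

theorem exists_int_charSum_of_isPowerClosed (h : IsPowerClosed C) (ψ : AddChar G ℂ) :
    ∃ m : ℤ, charSum C ψ = m := by
  classical
  rw [isPowerClosed_iff] at h
  choose f hf using ψ.exists_int_sum_generators
  have h1 : charSum C ψ = ∑ x with x ∈ C, ψ x := by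
    rw [charSum, Finset.sum_filter]
    refine Finset.sum_congr rfl fun x _ => ?_
    by_cases hx : x ∈ C <;> simp [hx]
  refine ⟨∑ L with ∃ g ∈ C, AddSubgroup.zmultiples g = L, f L, ?_⟩
  rw [h1, ← Finset.sum_fiberwise_of_maps_to
    (t := Finset.univ.filter fun L => ∃ g ∈ C, AddSubgroup.zmultiples g = L)
    (g := AddSubgroup.zmultiples)]
  · push_cast
    refine Finset.sum_congr rfl fun L hL => ?_
    rw [← hf]
    refine Finset.sum_congr ?_ fun _ _ => rfl
    ext x
    simp only [Finset.mem_filter, Finset.mem_univ, true_and] at hL ⊢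
    obtain ⟨g, hg, rfl⟩ := hL
    exact ⟨fun h => h.2, fun hx => ⟨h g x hx.symm hg, hx⟩⟩
  · intro x hx
    simp only [Finset.mem_filter, Finset.mem_univ, true_and] at hx ⊢
    exact ⟨x, hx, rfl⟩

end Integrality

/-! ### Slices of `C` over `ZMod 4` and characters of the product -/

section Slices

variable {G H : Type*} [AddCommGroup G] [AddCommGroup H] (e : G ≃+ ZMod 4 × H) (C : Set G)

/-- The elements `h` of `H` such that `(c, h)` corresponds to an element of `C`. -/
def slice (c : ZMod 4) : Set H := {h | e.symm (c, h) ∈ C}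

theorem mem_slice {c : ZMod 4} {h : H} : h ∈ slice e C c ↔ e.symm (c, h) ∈ C := Iff.rfl

/-- The character of `G ≃ ZMod 4 × H` given by a fourth root of unity and a character of `H`. -/
noncomputable def prodChar {ζ : ℂ} (hζ : ζ ^ 4 = 1) (χ : AddChar H ℂ) : AddChar G ℂ :=
  ((AddChar.zmodChar 4 hζ).compAddMonoidHom (AddMonoidHom.fst _ _) +
    χ.compAddMonoidHom (AddMonoidHom.snd _ _)).compAddMonoidHom e.toAddMonoidHom

theorem prodChar_apply {ζ : ℂ} (hζ : ζ ^ 4 = 1) (χ : AddChar H ℂ) (g : G) :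
    prodChar e hζ χ g = ζ ^ (e g).1.val * χ (e g).2 := by
  simp [prodChar, AddChar.zmodChar_apply]

theorem exists_eq_prodChar (ψ : AddChar G ℂ) :
    ∃ (ζ : ℂ) (hζ : ζ ^ 4 = 1) (χ : AddChar H ℂ), ψ = prodChar e hζ χ := by
  have hζ : ψ (e.symm (1, 0)) ^ 4 = 1 := by
    rw [← AddChar.map_nsmul_eq_pow, ← map_nsmul]
    have : (4 : ℕ) • ((1, 0) : ZMod 4 × H) = 0 := by
      ext
      · rfl
      · simp
    rw [this, map_zero, AddChar.map_zero_eq_one]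
  refine ⟨_, hζ, ψ.compAddMonoidHom (e.symm.toAddMonoidHom.comp (AddMonoidHom.inr _ _)), ?_⟩
  ext g
  rw [prodChar_apply, ← AddChar.map_nsmul_eq_pow, ← map_nsmul]
  simp only [AddChar.compAddMonoidHom_apply, AddMonoidHom.comp_apply, AddMonoidHom.inr_apply]
  change _ = _ * ψ (e.symm (0, (e g).2))
  rw [← AddChar.map_add_eq_mul, ← map_add]
  congr 1
  rw [AddEquiv.eq_symm_apply]
  ext <;> simp

variable [Fintype G] [Fintype H]

theorem charSum_prodChar {ζ : ℂ} (hζ : ζ ^ 4 = 1) (χ : AddChar H ℂ) :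
    charSum C (prodChar e hζ χ) =
      charSum (slice e C 0) χ + ζ * charSum (slice e C 1) χ +
        ζ ^ 2 * charSum (slice e C 2) χ + ζ ^ 3 * charSum (slice e C 3) χ := by
  have h1 : charSum C (prodChar e hζ χ) =
      ∑ c : ZMod 4, ∑ h, C.indicator 1 (e.symm (c, h)) * prodChar e hζ χ (e.symm (c, h)) := by
    rw [← Fintype.sum_prod_type']
    exact (Equiv.sum_comp e.symm.toEquiv fun x => C.indicator 1 x * prodChar e hζ χ x).symm
  have h2 : ∀ c : ZMod 4,
      ∑ h, C.indicator 1 (e.symm (c, h)) * prodChar e hζ χ (e.symm (c, h)) =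
        ζ ^ c.val * charSum (slice e C c) χ := by
    intro c
    rw [charSum, Finset.mul_sum]
    refine Finset.sum_congr rfl fun h _ => ?_
    rw [prodChar_apply, AddEquiv.apply_symm_apply]
    have h3 : C.indicator (1 : G → ℂ) (e.symm (c, h)) = (slice e C c).indicator 1 h := by
      by_cases hm : e.symm (c, h) ∈ C
      · simp [hm, (mem_slice e C).2 hm]
      · simp [hm, mt (mem_slice e C).1 hm]
    rw [h3]
    ring
  rw [h1, Finset.sum_congr rfl fun c _ => h2 c]
  change ∑ c : Fin 4, ζ ^ (c : ℕ) * charSum (slice e C c) χ = _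
  rw [Fin.sum_univ_four]
  simp only [Fin.val_zero, Fin.val_one, Fin.val_two, pow_zero, one_mul, pow_one]
  rfl

end Slices

/-! ### Fourier analysis on a group of odd order -/

section OddGroup

variable {H : Type*} [AddCommGroup H]

theorem charSum_eq_charSum_diff_zero [Fintype H] (S : Set H) (χ : AddChar H ℂ) :
    charSum S χ = charSum (S \ {0}) χ + S.indicator 1 0 := by
  classical
  have h : ∀ x, S.indicator (1 : H → ℂ) x * χ x =
      (S \ {0}).indicator 1 x * χ x + if x = 0 then S.indicator 1 0 else 0 := by
    intro x
    rcases eq_or_ne x 0 with rfl | hx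
    · simp
    · by_cases hS : x ∈ S <;> simp [hx, hS]
  simp only [charSum, h, Finset.sum_add_distrib]
  simp

theorem eq_zero_of_two_pow_nsmul_eq_zero (hH : Odd (Nat.card H)) {h : H} {k : ℕ}
    (h2 : 2 ^ k • h = 0) : h = 0 := by
  have h1 : addOrderOf h ∣ 2 ^ k := addOrderOf_dvd_of_nsmul_eq_zero h2
  have h3 : Nat.Coprime (2 ^ k) (Nat.card H) := (Nat.coprime_two_left.2 hH).pow_left k
  rw [← AddMonoid.addOrderOf_eq_one_iff]
  exact Nat.eq_one_of_dvd_coprimes h3 h1 (addOrderOf_dvd_natCard h)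

/-- If all Fourier coefficients of an integer function on a group of odd order are integers
divisible by `2 ^ N`, then so are the values of the function. -/
theorem two_pow_dvd_of_fourier [Fintype H] (hH : Odd (Nat.card H)) {w : H → ℤ} {N : ℕ}
    (hw : ∀ χ : AddChar H ℂ, ∃ z : ℤ, ∑ x, (w x : ℂ) * χ x = (2 ^ N * z : ℤ)) (h : H) :
    (2 : ℤ) ^ N ∣ w h := by
  choose z hz using hw
  have h1 := AddChar.sum_neg_mul_sum (fun x => (w x : ℂ)) h
  have h2 : (∑ χ : AddChar H ℂ, χ (-h) * z χ) = ((Fintype.card H * w h / 2 ^ N : ℚ) : ℂ) := by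
    push_cast
    rw [eq_div_iff (pow_ne_zero _ two_ne_zero), ← h1, Finset.sum_mul]
    refine Finset.sum_congr rfl fun χ _ => ?_
    rw [hz]
    push_cast
    ring
  -- By inversion `|H| w(h) / 2^N` is a rational algebraic integer; the odd factor `|H|` then drops
  -- out.
  have h3 : IsIntegral ℤ (((Fintype.card H * w h / 2 ^ N : ℚ) : ℚ) : ℂ) := by
    rw [← h2]
    exact IsIntegral.sum _ fun χ _ => (χ.isIntegral_apply _).mul (isIntegral_algebraMap (x := z χ))
  obtain ⟨n, hn⟩ := Complex.exists_int_of_isIntegral_ratCast h3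
  push_cast at hn
  rw [div_eq_iff (pow_ne_zero _ two_ne_zero)] at hn
  have h4 : (Fintype.card H : ℤ) * w h = n * 2 ^ N := by exact_mod_cast hn
  have h5 : IsCoprime ((2 : ℤ) ^ N) (Fintype.card H : ℤ) := by
    rw [Nat.card_eq_fintype_card] at hH
    exact_mod_cast Nat.isCoprime_iff_coprime.2 ((Nat.coprime_two_left.2 hH).pow_left N)
  exact h5.dvd_of_dvd_mul_left ⟨n, by rw [h4]; ring⟩

end OddGroup

/-! ### Element orders and condition (c) in terms of slices -/

section Orders

variable {G H : Type*} [AddCommGroup G] [AddCommGroup H] (e : G ≃+ ZMod 4 × H) (C : Set G)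

theorem ZMod.exists_addOrderOf_four_eq (c : ZMod 4) : ∃ i : ℕ, addOrderOf c = 2 ^ i := by
  have h : addOrderOf c ∣ 2 ^ 2 := by
    have := addOrderOf_dvd_natCard c
    rwa [Nat.card_zmod] at this
  obtain ⟨i, -, hi⟩ := (Nat.dvd_prime_pow Nat.prime_two).1 h
  exact ⟨i, hi⟩

theorem mem_image_twoPart_iff (hH : Odd (Nat.card H)) {k : ℕ} {c : ZMod 4} {h : H} :
    (c, h) ∈ e '' twoPart C k ↔ h ∈ slice e C c ∧ addOrderOf c = 2 ^ k := by
  have hodd : Odd (addOrderOf h) := hH.of_dvd_nat (addOrderOf_dvd_natCard h)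
  obtain ⟨i, hi⟩ := ZMod.exists_addOrderOf_four_eq c
  have hord : addOrderOf (e.symm (c, h)) = 2 ^ i * addOrderOf h := by
    have h1 : addOrderOf (e.symm (c, h)) = addOrderOf ((c, h) : ZMod 4 × H) :=
      addOrderOf_injective e.symm.toAddMonoidHom e.symm.injective _
    rw [h1, Prod.addOrderOf, hi]
    exact Nat.Coprime.lcm_eq_mul ((Nat.coprime_two_left.2 hodd).pow_left i)
  have himage : (c, h) ∈ e '' twoPart C k ↔ e.symm (c, h) ∈ twoPart C k := by
    constructor
    · rintro ⟨g, hg, hgc⟩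
      rwa [← hgc, AddEquiv.symm_apply_apply]
    · intro hg
      exact ⟨_, hg, e.apply_symm_apply _⟩
  rw [himage, mem_slice, hi]
  refine and_congr_right fun _ => ?_
  rw [hord]
  constructor
  · rintro ⟨m, hm, h2⟩
    have h3 := congrArg (padicValNat 2) h2
    have hp : ∀ n : ℕ, Odd n → padicValNat 2 n = 0 := fun n hn =>
      padicValNat.eq_zero_of_not_dvd hn.not_two_dvd_nat
    rw [padicValNat.mul (by positivity) hodd.pos.ne', padicValNat.mul (by positivity) hm.pos.ne',
      padicValNat.prime_pow, padicValNat.prime_pow, hp _ hodd, hp _ hm] at h3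
    rw [show i = k by omega]
  · intro h2
    exact ⟨_, hodd, by rw [h2]⟩

theorem ZMod.addOrderOf_four (c : ZMod 4) :
    (addOrderOf c = 2 ^ 0 ↔ c = 0) ∧ (addOrderOf c = 2 ^ 1 ↔ c = 2) ∧
      (addOrderOf c = 2 ^ 2 ↔ c = 1 ∨ c = 3) := by
  have h : addOrderOf c = 4 / Nat.gcd 4 c.val := by
    have := ZMod.addOrderOf_coe c.val (n := 4) (by norm_num)
    rwa [ZMod.natCast_zmod_val] at this
  rw [h]
  clear h
  revert c
  decide

theorem apply_eq_of_addOrderOf_eq_two_pow (hH : Odd (Nat.card H)) {g : G} {k : ℕ}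
    (hg : addOrderOf g = 2 ^ k) : (e g).2 = 0 ∧ addOrderOf (e g).1 = 2 ^ k := by
  have h1 : addOrderOf (e g) = 2 ^ k := by
    rw [← hg]
    exact addOrderOf_injective e.toAddMonoidHom e.injective _
  have h2 : (e g).2 = 0 := by
    apply eq_zero_of_two_pow_nsmul_eq_zero hH (k := k)
    rw [← Prod.smul_snd, ← h1, addOrderOf_nsmul_eq_zero]
    rfl
  refine ⟨h2, ?_⟩
  rw [Prod.addOrderOf, h2, addOrderOf_zero, Nat.lcm_one_right] at h1
  exact h1

/-- The 2-part of the order depends only on the `ZMod 4` component: 0, 2, or one of 1 and 3.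
Equality of slices 1 and 3 is exactly what makes the order-four part a product. -/
theorem exists_twoPart_sets_iff (hH : Odd (Nat.card H)) {α β : ZMod 4} (hα : α = 2)
    (hβ : β = 1 ∨ β = 3) :
    (∃ C₀ C₁s C₂s : Set H,
        e '' twoPart C 0 = ({0} : Set (ZMod 4)) ×ˢ C₀ ∧
        e '' twoPart C 1 = ({α} : Set (ZMod 4)) ×ˢ C₁s ∧
        e '' twoPart C 2 = ({β, -β} : Set (ZMod 4)) ×ˢ C₂s ∧
        C₀ = C₁s \ {0} ∧ C₁s \ {0} = C₂s \ {0}) ↔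
      slice e C 1 = slice e C 3 ∧ slice e C 0 = slice e C 2 \ {0} ∧
        slice e C 2 \ {0} = slice e C 1 \ {0} := by
  have hβ' : ({β, -β} : Set (ZMod 4)) = {1, 3} := by
    rcases hβ with rfl | rfl
    · rfl
    · rw [Set.pair_comm]
      rfl
  rw [hα, hβ']
  constructor
  · rintro ⟨C₀, C₁s, C₂s, h0, h1, h2, h3, h4⟩
    have key : ∀ (k : ℕ) (S : Set (ZMod 4)) (D : Set H), e '' twoPart C k = S ×ˢ D →
        ∀ c ∈ S, addOrderOf c = 2 ^ k → slice e C c = D := by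
      intro k S D hS c hc hck
      ext h
      have := mem_image_twoPart_iff e C hH (k := k) (c := c) (h := h)
      rw [hS, Set.mem_prod] at this
      tauto
    have e0 := key 0 _ _ h0 0 (by simp) ((ZMod.addOrderOf_four 0).1.2 rfl)
    have e1 := key 1 _ _ h1 2 (by simp) ((ZMod.addOrderOf_four 2).2.1.2 rfl)
    have e2 := key 2 _ _ h2 1 (by simp) ((ZMod.addOrderOf_four 1).2.2.2 (Or.inl rfl))
    have e3 := key 2 _ _ h2 3 (by simp) ((ZMod.addOrderOf_four 3).2.2.2 (Or.inr rfl))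
    rw [e0, e1, e2, e3]
    exact ⟨rfl, h3, h4⟩
  · rintro ⟨h1, h2, h3⟩
    refine ⟨slice e C 0, slice e C 2, slice e C 1, ?_, ?_, ?_, h2, h3⟩
    · ext ⟨c, h⟩
      rw [mem_image_twoPart_iff e C hH, (ZMod.addOrderOf_four c).1]
      simp only [Set.mem_prod, Set.mem_singleton_iff]
      constructor <;> rintro ⟨h, h'⟩ <;> simp_all
    · ext ⟨c, h⟩
      rw [mem_image_twoPart_iff e C hH, (ZMod.addOrderOf_four c).2.1]
      simp only [Set.mem_prod, Set.mem_singleton_iff]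
      constructor
      · rintro ⟨h, rfl⟩
        exact ⟨rfl, h⟩
      · rintro ⟨rfl, h⟩
        exact ⟨h, rfl⟩
    · ext ⟨c, h⟩
      rw [mem_image_twoPart_iff e C hH, (ZMod.addOrderOf_four c).2.2]
      simp only [Set.mem_prod, Set.mem_insert_iff, Set.mem_singleton_iff]
      constructor
      · rintro ⟨h, rfl | rfl⟩
        · exact ⟨Or.inl rfl, h⟩
        · exact ⟨Or.inr rfl, h1 ▸ h⟩
      · rintro ⟨rfl | rfl, h⟩
        · exact ⟨h, Or.inl rfl⟩
        · exact ⟨h1 ▸ h, Or.inr rfl⟩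

end Orders

/-! ### From transfer to slices and back -/

section Main

variable {G H : Type*} [AddCommGroup G] [AddCommGroup H] (e : G ≃+ ZMod 4 × H) {C : Set G}

theorem prodChar_symm_two {ζ : ℂ} (hζ : ζ ^ 4 = 1) (χ : AddChar H ℂ) :
    prodChar e hζ χ (e.symm (2, 0)) = ζ ^ 2 := by
  rw [prodChar_apply, AddEquiv.apply_symm_apply, AddChar.map_zero_eq_one, mul_one]
  rfl

theorem isPowerClosed_slice_zero [Finite G] (hC : IsPowerClosed C) :
    IsPowerClosed (slice e C 0) := by
  rw [isPowerClosed_iff] at hC ⊢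
  intro g h hgh hg
  let f : H →+ G := e.symm.toAddMonoidHom.comp (AddMonoidHom.inr (ZMod 4) H)
  refine hC (f g) (f h) ?_ hg
  rw [← AddMonoidHom.map_zmultiples, hgh, AddMonoidHom.map_zmultiples]

theorem slice_one_eq_slice_three [Finite G] (hH : Odd (Nat.card H)) (hC : IsPowerClosed C) :
    slice e C 1 = slice e C 3 := by
  rw [isPowerClosed_iff_nsmul] at hC
  have hcard : Nat.card G = 4 * Nat.card H := by
    rw [Nat.card_congr e.toEquiv, Nat.card_prod, Nat.card_zmod]
  have hpos : 0 < Nat.card H := hH.pos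
  -- This multiplier is prime to `4|H|`, fixes `H`, and acts as 3 on `ZMod 4` because `|H|` is odd.
  set k := 2 * Nat.card H + 1 with hk
  have hcop : (Nat.card G).Coprime k := by
    rw [hcard]
    have h2 : Nat.Coprime 2 k := Nat.coprime_two_left.2 ⟨Nat.card H, hk⟩
    have h4 : Nat.Coprime (2 ^ 2) k := h2.pow_left 2
    refine Nat.Coprime.mul_left h4 ?_
    simp [hk]
  have h2 : ((2 * Nat.card H : ℕ) : ZMod 4) = 2 := by
    obtain ⟨t, ht⟩ := hH
    rw [ht, show 2 * (2 * t + 1) = 4 * t + 2 by ring]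
    push_cast
    rw [show (4 : ZMod 4) = 0 from rfl]
    simp
  have hsmul : ∀ (c : ZMod 4) (h : H), k • (c, h) = (2 * c + c, h) := by
    intro c h
    ext
    · simp only [Prod.smul_mk, nsmul_eq_mul, hk, Nat.cast_add, h2, Nat.cast_one]
      ring
    · simp only [Prod.smul_mk, hk, add_smul, one_smul, mul_smul, card_nsmul_eq_zero', smul_zero,
        Prod.snd_add, zero_add]
  have hstep : ∀ (c : ZMod 4) (h : H), h ∈ slice e C c → h ∈ slice e C (2 * c + c) := by
    intro c h hh
    have := hC k hcop _ hh
    rwa [← map_nsmul, hsmul] at this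
  exact Set.Subset.antisymm (fun h hh => hstep 1 h hh) (fun h hh => hstep 3 h hh)

theorem eq_symm_two_of_add_self (hH : Odd (Nat.card H)) {d : G} (hd : d ≠ 0) (hd2 : d + d = 0) :
    d = e.symm (2, 0) := by
  have h1 : e d + e d = 0 := by rw [← map_add, hd2, map_zero]
  have h2 : (e d).2 = 0 := by
    apply eq_zero_of_two_pow_nsmul_eq_zero hH (k := 1)
    rw [pow_one, two_smul]
    exact congrArg Prod.snd h1
  have h3 : (e d).1 + (e d).1 = 0 := congrArg Prod.fst h1
  have h4 : (e d).1 ≠ 0 := by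
    intro h
    exact hd ((map_eq_zero_iff e e.injective).1 (Prod.ext h h2))
  have h5 : ∀ c : ZMod 4, c + c = 0 → c ≠ 0 → c = 2 := by decide
  rw [AddEquiv.eq_symm_apply]
  exact Prod.ext (h5 _ h3 h4) h2

variable [Fintype G] [DecidableEq G] [Fintype H]

/-- The conditions on the slices force the `2`-adic valuations of the eigenvalue differences,
giving transfer at time `π / 2`. -/
theorem admitsPST_of_slices (h0 : (0 : G) ∉ C) (hneg : ∀ g ∈ C, -g ∈ C)
    (hC : IsPowerClosed C) (hxor : Xor ((0 : H) ∈ slice e C 2) ((0 : H) ∈ slice e C 1))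
    (h13 : slice e C 1 = slice e C 3) (h02 : slice e C 0 = slice e C 2 \ {0})
    (h21 : slice e C 2 \ {0} = slice e C 1 \ {0}) :
    AdmitsPST (SimpleGraph.addCayley C) := by
  rw [admitsPST_addCayley_iff h0 hneg]
  choose m hm using exists_int_charSum_of_isPowerClosed hC
  choose x hx using exists_int_charSum_of_isPowerClosed (isPowerClosed_slice_zero e hC)
  -- `s` and `t` record whether `0` lies in slices 2 and 1; apart from that, all slices share the
  -- character sum `x`.
  obtain ⟨s, t, hst, hs, ht⟩ : ∃ s t : ℤ, s + t = 1 ∧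
      (slice e C 2).indicator (1 : H → ℂ) 0 = s ∧ (slice e C 1).indicator (1 : H → ℂ) 0 = t := by
    rcases hxor with ⟨h1, h2⟩ | ⟨h1, h2⟩
    · exact ⟨1, 0, by norm_num, by simp [h1], by simp [h2]⟩
    · exact ⟨0, 1, by norm_num, by simp [h2], by simp [h1]⟩
  have h2 : ∀ χ, charSum (slice e C 2) χ = x χ + s := fun χ => by
    rw [charSum_eq_charSum_diff_zero, ← h02, hx, hs]
  have h1 : ∀ χ, charSum (slice e C 1) χ = x χ + t := fun χ => by
    rw [charSum_eq_charSum_diff_zero, ← h21, ← h02, hx, ht]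
  have hformula : ∀ {ζ : ℂ} (hζ : ζ ^ 4 = 1) (χ : AddChar H ℂ),
      (m (prodChar e hζ χ) : ℂ) =
        x χ + ζ * (x χ + t) + ζ ^ 2 * (x χ + s) + ζ ^ 3 * (x χ + t) := by
    intro ζ hζ χ
    rw [← hm, charSum_prodChar, ← h13, hx, h2, h1]
  have hzero : m 0 = 4 * x 0 + s + 2 * t := by
    have h3 : (0 : AddChar G ℂ) = prodChar e (one_pow 4) 0 := by
      ext g
      simp [prodChar_apply]
    have h4 := hformula (one_pow 4) 0
    rw [← h3] at h4
    have h5 : (m 0 : ℂ) = 4 * x 0 + s + 2 * t := by rw [h4]; ring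
    exact_mod_cast h5
  refine ⟨e.symm (2, 0), ?_, m, 1, fun ψ => ⟨hm ψ, ?_⟩⟩
  · rw [Ne, map_eq_zero_iff e.symm e.symm.injective]
    intro h
    exact absurd (congrArg Prod.fst h) (show (2 : ZMod 4) ≠ 0 by decide)
  obtain ⟨ζ, hζ, χ, rfl⟩ := exists_eq_prodChar e ψ
  rw [prodChar_symm_two]
  have h3 := hformula hζ χ
  have hsq : ζ ^ 2 = 1 ∨ ζ ^ 2 = -1 := by
    rw [← sq_eq_one_iff, ← pow_mul]
    exact hζ
  rcases hsq with hsq | hsq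
  · left
    refine ⟨hsq, ?_⟩
    rcases sq_eq_one_iff.1 hsq with rfl | rfl
    · have h4 : (m (prodChar e hζ χ) : ℂ) = 4 * x χ + s + 2 * t := by rw [h3]; ring
      have h5 : m (prodChar e hζ χ) = 4 * x χ + s + 2 * t := by exact_mod_cast h4
      rw [h5, hzero]
      exact ⟨x χ - x 0, by ring⟩
    · have h4 : (m (prodChar e hζ χ) : ℂ) = s - 2 * t := by rw [h3]; ring
      have h5 : m (prodChar e hζ χ) = s - 2 * t := by exact_mod_cast h4
      rw [h5, hzero]
      exact ⟨-x 0 - t, by ring⟩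
  · right
    refine ⟨hsq, ?_⟩
    have h4 : (m (prodChar e hζ χ) : ℂ) = -s := by
      rw [h3]
      linear_combination (x χ + s + ζ * (x χ + t)) * hsq
    have h5 : m (prodChar e hζ χ) = -s := by exact_mod_cast h4
    rw [h5, hzero]
    exact ⟨-x 0 - 1, by linear_combination (-2 : ℤ) * hst⟩

/-- The pointwise consequence of the parity conditions for a character of order four, the trivial
character and the quadratic character of `ZMod 4`, away from the identity. -/
theorem eq_of_two_pow_dvd_of_zero_one {α : ℕ} {p q r : ℤ} (hα : 1 ≤ α) (hp : p = 0 ∨ p = 1)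
    (hq : q = 0 ∨ q = 1) (hr : r = 0 ∨ r = 1) (h1 : (2 : ℤ) ^ (α + 1) ∣ p - q)
    (h2 : (2 : ℤ) ^ (α + 1) ∣ p + q + 2 * r) : p = q ∧ q = r := by
  have h4 : (4 : ℤ) ∣ 2 ^ (α + 1) := by
    have := pow_dvd_pow (2 : ℤ) (show 2 ≤ α + 1 by omega)
    norm_num at this
    exact this
  have h5 := h4.trans h1
  have h6 := h4.trans h2
  omega

/-- The consequence of the parity conditions at the identity. -/
theorem sum_eq_one_of_two_pow_dvd_of_zero_one {α : ℕ} {q r k : ℤ}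
    (hq : q = 0 ∨ q = 1) (hr : r = 0 ∨ r = 1)
    (h1 : (2 : ℤ) ^ (α + 1) ∣ 0 - q - (k + 2 ^ α)) (h2 : (2 : ℤ) ^ (α + 1) ∣ 0 + q + 2 * r - k)
    (h3 : (2 : ℤ) ^ (α + 1) ∣ 0 + q - 2 * r - k) : 1 ≤ α ∧ q + r = 1 := by
  obtain rfl | rfl | ⟨β, rfl⟩ : α = 0 ∨ α = 1 ∨ ∃ β, α = β + 2 := by
    rcases α with _ | _ | β
    · exact Or.inl rfl
    · exact Or.inr (Or.inl rfl)
    · exact Or.inr (Or.inr ⟨β, rfl⟩)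
  · omega
  · omega
  · exfalso
    have h8 : (2 : ℤ) ^ (β + 2 + 1) = 8 * 2 ^ β := by ring
    have h4 : (2 : ℤ) ^ (β + 2) = 4 * 2 ^ β := by ring
    rw [h8] at h1 h2 h3
    rw [h4] at h1
    have h5 := (dvd_mul_right (8 : ℤ) (2 ^ β)).trans h2
    have h6 := (dvd_mul_right (8 : ℤ) (2 ^ β)).trans h3
    -- Subtracting the two congruences modulo 8 leaves `4r`. What remains is `2^(β+3) ∣ 2q +
    -- 2^(β+2)`, impossible for `q` equal to 0 or 1.
    have hr0 : r = 0 := by omega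
    have h7 := dvd_sub h2 h1
    obtain ⟨t, ht⟩ := h7
    have hpos : (0 : ℤ) < 2 ^ β := by positivity
    rcases hq with rfl | rfl
    · have h9 : (2 : ℤ) ^ β * 4 = 2 ^ β * (8 * t) := by rw [hr0] at ht; linarith
      have := mul_left_cancel₀ hpos.ne' h9
      omega
    · rw [hr0] at ht
      generalize (2 : ℤ) ^ β * t = y at *
      have : 8 * 2 ^ β * t = 8 * (2 ^ β * t) := by ring
      omega

theorem slices_of_admitsPST (hH : Odd (Nat.card H)) (h0 : (0 : G) ∉ C)
    (hneg : ∀ g ∈ C, -g ∈ C) (h : AdmitsPST (SimpleGraph.addCayley C)) :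
    IsPowerClosed C ∧ Xor ((0 : H) ∈ slice e C 2) ((0 : H) ∈ slice e C 1) ∧
      slice e C 1 = slice e C 3 ∧ slice e C 0 = slice e C 2 \ {0} ∧
      slice e C 2 \ {0} = slice e C 1 \ {0} := by
  classical
  obtain ⟨d, hd, m, α, hm⟩ := (admitsPST_addCayley_iff h0 hneg).1 h
  have hC : IsPowerClosed C := isPowerClosed_of_int_charSum fun ψ => ⟨m ψ, (hm ψ).1⟩
  have h13 := slice_one_eq_slice_three e hH hC
  have hd2 : d + d = 0 := by
    rw [← AddChar.forall_apply_eq_zero]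
    intro ψ
    rw [AddChar.map_add_eq_mul]
    rcases (hm ψ).2 with ⟨h1, -⟩ | ⟨h1, -⟩ <;> simp [h1]
  have hd' := eq_symm_two_of_add_self e hH hd hd2
  let f : ZMod 4 → H → ℤ := fun c => (slice e C c).indicator 1
  have hf : ∀ c x, (f c x = 0 ∨ f c x = 1) ∧ (x ∈ slice e C c ↔ f c x = 1) := by
    intro c x
    by_cases hx : x ∈ slice e C c <;> simp [f, hx]
  have hcharSum : ∀ c χ, charSum (slice e C c) χ = ∑ x, (f c x : ℂ) * χ x := by
    intro c χ
    refine Finset.sum_congr rfl fun x _ => ?_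
    by_cases hx : x ∈ slice e C c <;> simp [f, hx]
  have hsingle : ∀ (k : ℤ) (χ : AddChar H ℂ),
      ∑ x, ((Pi.single 0 k : H → ℤ) x : ℂ) * χ x = k := by
    intro k χ
    rw [Finset.sum_eq_single 0 (fun x _ hx => by simp [hx]) (by simp)]
    simp
  have heven : ∀ {ζ : ℂ} (hζ : ζ ^ 4 = 1) (_ : ζ ^ 2 = 1) (χ : AddChar H ℂ),
      (2 : ℤ) ^ (α + 1) ∣ m (prodChar e hζ χ) - m 0 := by
    intro ζ hζ hζ2 χ
    have := (hm (prodChar e hζ χ)).2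
    rw [hd', prodChar_symm_two, hζ2] at this
    rcases this with ⟨-, h1⟩ | ⟨h1, -⟩
    · exact h1
    · norm_num at h1
  have hodd : ∀ {ζ : ℂ} (hζ : ζ ^ 4 = 1) (_ : ζ ^ 2 = -1) (χ : AddChar H ℂ),
      (2 : ℤ) ^ (α + 1) ∣ m (prodChar e hζ χ) - m 0 - 2 ^ α := by
    intro ζ hζ hζ2 χ
    have := (hm (prodChar e hζ χ)).2
    rw [hd', prodChar_symm_two, hζ2] at this
    rcases this with ⟨h1, -⟩ | ⟨-, h1⟩
    · norm_num at h1
    · exact h1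
  -- At `ζ = i` the equal slices 1 and 3 cancel. A point mass at `0` has constant Fourier transform,
  -- so subtracting it absorbs the constant `m 0 + 2^α`.
  have hI : ∀ x, (2 : ℤ) ^ (α + 1) ∣
      f 0 x - f 2 x - (Pi.single 0 (m 0 + 2 ^ α) : H → ℤ) x := by
    refine two_pow_dvd_of_fourier hH fun χ => ?_
    obtain ⟨z, hz⟩ := hodd Complex.I_pow_four Complex.I_sq χ
    refine ⟨z, ?_⟩
    rw [← hz]
    have h1 := (hm (prodChar e Complex.I_pow_four χ)).1
    rw [charSum_prodChar, ← h13, hcharSum, hcharSum, hcharSum] at h1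
    push_cast
    simp only [sub_mul, Finset.sum_sub_distrib, hsingle]
    push_cast
    linear_combination h1 -
      (∑ x, (f 2 x : ℂ) * χ x + Complex.I * ∑ x, (f 1 x : ℂ) * χ x) * Complex.I_sq
  have hplus : ∀ x, (2 : ℤ) ^ (α + 1) ∣
      f 0 x + f 2 x + 2 * f 1 x - (Pi.single 0 (m 0) : H → ℤ) x := by
    refine two_pow_dvd_of_fourier hH fun χ => ?_
    obtain ⟨z, hz⟩ := heven (one_pow 4) (one_pow 2) χ
    refine ⟨z, ?_⟩
    rw [← hz]
    have h1 := (hm (prodChar e (one_pow 4) χ)).1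
    rw [charSum_prodChar, ← h13, hcharSum, hcharSum, hcharSum] at h1
    push_cast
    simp only [sub_mul, add_mul, mul_assoc, Finset.sum_sub_distrib, Finset.sum_add_distrib,
      ← Finset.mul_sum, hsingle]
    linear_combination h1
  have hminus : ∀ x, (2 : ℤ) ^ (α + 1) ∣
      f 0 x + f 2 x - 2 * f 1 x - (Pi.single 0 (m 0) : H → ℤ) x := by
    have hζ : (-1 : ℂ) ^ 4 = 1 := by norm_num
    refine two_pow_dvd_of_fourier hH fun χ => ?_
    obtain ⟨z, hz⟩ := heven hζ (by norm_num) χ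
    refine ⟨z, ?_⟩
    rw [← hz]
    have h1 := (hm (prodChar e hζ χ)).1
    rw [charSum_prodChar, ← h13, hcharSum, hcharSum, hcharSum] at h1
    push_cast
    simp only [sub_mul, add_mul, mul_assoc, Finset.sum_sub_distrib, Finset.sum_add_distrib,
      ← Finset.mul_sum, hsingle]
    linear_combination h1
  have hf0 : (0 : H) ∉ slice e C 0 := by
    rw [mem_slice]
    change e.symm 0 ∉ C
    rwa [map_zero]
  have hf00 : f 0 0 = 0 := by simp [f, hf0]
  have hI0 := hI 0
  have hplus0 := hplus 0
  have hminus0 := hminus 0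
  rw [hf00, Pi.single_eq_same] at hI0 hplus0 hminus0
  obtain ⟨hα, hsum⟩ :=
    sum_eq_one_of_two_pow_dvd_of_zero_one (hf 2 0).1 (hf 1 0).1 hI0 hplus0 hminus0
  have hne : ∀ x, x ≠ 0 → f 0 x = f 2 x ∧ f 2 x = f 1 x := by
    intro x hx
    have h1 := hI x
    have h2 := hplus x
    rw [Pi.single_eq_of_ne hx, sub_zero] at h1 h2
    exact eq_of_two_pow_dvd_of_zero_one hα (hf 0 x).1 (hf 2 x).1 (hf 1 x).1 h1 h2
  refine ⟨hC, ?_, h13, ?_, ?_⟩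
  · unfold Xor
    rw [(hf 2 0).2, (hf 1 0).2]
    have h1 := (hf 2 0).1
    omega
  · ext x
    rcases eq_or_ne x 0 with rfl | hx
    · simp [hf0]
    · simp [hx, (hf _ x).2, (hne x hx).1]
  · ext x
    rcases eq_or_ne x 0 with rfl | hx
    · simp
    · simp [hx, (hf _ x).2, (hne x hx).2]

end Main

theorem theorem7p3 {G H : Type*} [AddCommGroup G] [Fintype G] [DecidableEq G] [AddCommGroup H]
    (hH : Odd (Nat.card H)) (e : G ≃+ ZMod 4 × H)
    (a b : G) (ha : addOrderOf a = 2) (hb : addOrderOf b = 4)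
    (C : Set G) (hC_zero : (0 : G) ∉ C) (hC_neg : ∀ g ∈ C, -g ∈ C) :
    AdmitsPST (SimpleGraph.addCayley C) ↔
      IsPowerClosed C ∧
      Xor (a ∈ C) (b ∈ C) ∧
      ∃ C₀ C₁s C₂s : Set H,
        e '' twoPart C 0 = ({0} : Set (ZMod 4)) ×ˢ C₀ ∧
        e '' twoPart C 1 = ({(e a).1} : Set (ZMod 4)) ×ˢ C₁s ∧
        e '' twoPart C 2 = ({(e b).1, -(e b).1} : Set (ZMod 4)) ×ˢ C₂s ∧
        C₀ = C₁s \ {0} ∧ C₁s \ {0} = C₂s \ {0} := by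
  have : Finite H := Nat.finite_of_card_ne_zero hH.pos.ne'
  have := Fintype.ofFinite H
  obtain ⟨ha2, ha1⟩ := apply_eq_of_addOrderOf_eq_two_pow e hH (k := 1) ha
  obtain ⟨hb2, hb1⟩ := apply_eq_of_addOrderOf_eq_two_pow e hH (k := 2) hb
  rw [(ZMod.addOrderOf_four _).2.1] at ha1
  rw [(ZMod.addOrderOf_four _).2.2] at hb1
  rw [exists_twoPart_sets_iff e C hH ha1 hb1]
  have hmem : ∀ g : G, (e g).2 = 0 → (g ∈ C ↔ (0 : H) ∈ slice e C (e g).1) := by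
    intro g hg
    rw [mem_slice, ← hg, Prod.mk.eta, AddEquiv.symm_apply_apply]
  -- `b` may lie over either 1 or 3, so the two slices must be known to agree.
  have hxor : slice e C 1 = slice e C 3 →
      (Xor (a ∈ C) (b ∈ C) ↔ Xor ((0 : H) ∈ slice e C 2) ((0 : H) ∈ slice e C 1)) := by
    intro h13
    rw [hmem a ha2, hmem b hb2, ha1]
    rcases hb1 with hb1 | hb1
    · rw [hb1]
    · rw [hb1, h13]
  constructor
  · intro h
    obtain ⟨h1, h2, h3, h4⟩ := slices_of_admitsPST e hH hC_zero hC_neg h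
    exact ⟨h1, (hxor h3).2 h2, h3, h4⟩
  · rintro ⟨h1, h2, h3, h4, h5⟩
    exact admitsPST_of_slices e hC_zero hC_neg h1 ((hxor h3).1 h2) h3 h4 h5
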